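/- Let $H$ and $K$ be complex infinite-dimensional separable Hilbert spaces, and let $A\in B(H)$ and $B\in B(K)$ be bounded linear operators. For $C\in B(K,H)$ (a bounded linear operator from $K$ to $H$) let $$M_C=\begin{pmatrix}A&C\\0&B\end{pmatrix}\in B(H\oplus K),\qquad M_C(x,y)=(Ax+Cy,\,By).$$ For a bounded operator $T$ on a complex Hilbert space $X$, with kernel $N(T)$ and range $R(T)$, put $\alpha(T)=\dim N(T)$ and $\beta(T)=\dim X/R(T)$, with values in $\{0,1,2,\dots,\infty\}$ (all infinite dimensions are written $\infty$), and let $$\mathrm{asc}(T)=\inf\{k\ge 0: N(T^k)=N(T^{k+1})\},\qquad \mathrm{des}(T)=\inf\{k\ge 0: R(T^k)=R(T^{k+1})\},$$ with $\inf\emptyset=\infty$. The operator $T$ is called * *Browder* if $\alpha(T)<\infty$, $\beta(T)<\infty$ and $\mathrm{asc}(T)=\mathrm{des}(T)<\infty$; * *left semi-Browder* if $R(T)$ is closed and complemented in $X$, $\alpha(T)<\infty$ and $\mathrm{asc}(T)<\infty$; * *right semi-Browder* if $N(T)$ is closed and complemented in $X$, $\beta(T)<\infty$ and $\mathrm{des}(T)<\infty$.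 Let $\sigma_b(T)$, $\sigma_{lb}(T)$ and $\sigma_{rb}(T)$ be the sets of all $\lambda\in\mathbb C$ for which $T-\lambda$ is not Browder, not left semi-Browder and not right semi-Browder, respectively. Then $$\bigcap_{C\in B(K,H)}\sigma_b(M_C)=\sigma_{lb}(A)\cup\sigma_{rb}(B)\cup\{\lambda\in\mathbb C:\ \alpha(A-\lambda)+\alpha(B-\lambda)\neq\beta(A-\lambda)+\beta(B-\lambda)\}.$$ -/

import Mathlib

noncomputable section

namespace BrowderSpectrum

section Operators

variable {X : Type*} [NormedAddCommGroup X] [NormedSpace ℂ X]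

/-- `α(T) = dim N(T)`, with values in `{0, 1, 2, …, ∞}`. -/
def nullity (T : X →L[ℂ] X) : ℕ∞ :=
  Cardinal.toENat (Module.rank ℂ (LinearMap.ker (T : X →ₗ[ℂ] X)))

/-- `β(T) = dim X / R(T)`, with values in `{0, 1, 2, …, ∞}`. -/
def defect (T : X →L[ℂ] X) : ℕ∞ :=
  Cardinal.toENat (Module.rank ℂ (X ⧸ LinearMap.range (T : X →ₗ[ℂ] X)))

/-- The ascent `inf {k : N(T^k) = N(T^(k+1))}`; it is `∞` if there is no such `k`. -/
def ascent (T : X →L[ℂ] X) : ℕ∞ :=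
  sInf {m : ℕ∞ | ∃ k : ℕ, m = (k : ℕ∞) ∧
    LinearMap.ker ((T ^ k : X →L[ℂ] X) : X →ₗ[ℂ] X) =
      LinearMap.ker ((T ^ (k + 1) : X →L[ℂ] X) : X →ₗ[ℂ] X)}

/-- The descent `inf {k : R(T^k) = R(T^(k+1))}`; it is `∞` if there is no such `k`. -/
def descent (T : X →L[ℂ] X) : ℕ∞ :=
  sInf {m : ℕ∞ | ∃ k : ℕ, m = (k : ℕ∞) ∧
    LinearMap.range ((T ^ k : X →L[ℂ] X) : X →ₗ[ℂ] X) =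
      LinearMap.range ((T ^ (k + 1) : X →L[ℂ] X) : X →ₗ[ℂ] X)}

/-- Fredholm operators: `α(T) < ∞` and `β(T) < ∞`. On a Banach space the range is then automatically
closed, and this is equivalent to `ContinuousLinearMap.IsFredholm`. -/
def IsFredholm (T : X →L[ℂ] X) : Prop :=
  nullity T < ⊤ ∧ defect T < ⊤

/-- Left semi-Fredholm operators: `R(T)` is closed and complemented, and `α(T) < ∞`. -/
def IsLeftSemiFredholm (T : X →L[ℂ] X) : Prop :=
  IsClosed (LinearMap.range (T : X →ₗ[ℂ] X) : Set X) ∧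
    (LinearMap.range (T : X →ₗ[ℂ] X)).ClosedComplemented ∧ nullity T < ⊤

/-- Right semi-Fredholm operators: `N(T)` is closed and complemented, and `β(T) < ∞`. -/
def IsRightSemiFredholm (T : X →L[ℂ] X) : Prop :=
  IsClosed (LinearMap.ker (T : X →ₗ[ℂ] X) : Set X) ∧
    (LinearMap.ker (T : X →ₗ[ℂ] X)).ClosedComplemented ∧ defect T < ⊤

/-- Browder operators: Fredholm operators with equal and finite ascent and descent. -/
def IsBrowder (T : X →L[ℂ] X) : Prop :=
  IsFredholm T ∧ ascent T = descent T ∧ descent T < ⊤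

/-- Left semi-Browder operators: left semi-Fredholm operators of finite ascent. -/
def IsLeftSemiBrowder (T : X →L[ℂ] X) : Prop :=
  IsLeftSemiFredholm T ∧ ascent T < ⊤

/-- Right semi-Browder operators: right semi-Fredholm operators of finite descent. -/
def IsRightSemiBrowder (T : X →L[ℂ] X) : Prop :=
  IsRightSemiFredholm T ∧ descent T < ⊤

/-- The operator `T - λ`. -/
def shift (T : X →L[ℂ] X) (l : ℂ) : X →L[ℂ] X :=
  T - l • ContinuousLinearMap.id ℂ X

/-- The Browder spectrum `σ_b(T)`. -/
def browderSpectrum (T : X →L[ℂ] X) : Set ℂ :=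
  {l | ¬ IsBrowder (shift T l)}

/-- The left semi-Browder spectrum `σ_lb(T)`. -/
def leftBrowderSpectrum (T : X →L[ℂ] X) : Set ℂ :=
  {l | ¬ IsLeftSemiBrowder (shift T l)}

/-- The right semi-Browder spectrum `σ_rb(T)`. -/
def rightBrowderSpectrum (T : X →L[ℂ] X) : Set ℂ :=
  {l | ¬ IsRightSemiBrowder (shift T l)}

end Operators

section Matrices

variable {H K : Type*} [NormedAddCommGroup H] [InnerProductSpace ℂ H]
  [NormedAddCommGroup K] [InnerProductSpace ℂ K]

/-- The operator matrix `M_C = (A C; 0 B)`, `(x, y) ↦ (A x + C y, B y)`, on the Hilbert space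
direct sum `H ⊕ K`. -/
def upperTriangular (A : H →L[ℂ] H) (B : K →L[ℂ] K) (C : K →L[ℂ] H) :
    WithLp 2 (H × K) →L[ℂ] WithLp 2 (H × K) :=
  ((WithLp.prodContinuousLinearEquiv 2 ℂ H K).symm : H × K →L[ℂ] WithLp 2 (H × K)) ∘L
    ((A.coprod C).prod (B ∘L ContinuousLinearMap.snd ℂ H K)) ∘L
      (WithLp.prodContinuousLinearEquiv 2 ℂ H K : WithLp 2 (H × K) →L[ℂ] H × K)

end Matrices

end BrowderSpectrum

end

/-!
Replacing `A` and `B` by `A - λ` and `B - λ`, it has to be shown that `M_C` is Browder for some `C`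
if and only if `A` is left semi-Browder, `B` is right semi-Browder and
`α(A) + α(B) = β(A) + β(B)`.

Suppose that `M_C` is Browder. The operator `A` is the restriction of `M_C` to an invariant subspace
and `B` is the operator induced on the quotient, so `A` inherits finite ascent and `B` finite
descent. The dimension count of the snake lemma (`exists_nullity_defect_upperTriangular`) gives
`α(A) < ∞`, `β(B) < ∞` and `α(A) + α(B) + β(M_C) = α(M_C) + β(A) + β(B)`, and
`α(M_C) = β(M_C) < ∞` because a Fredholm operator with finite ascent and descent has index zero
(`extDim_ker_eq_extDim_quotient_range_of_stable`). That `R(A)` is closed follows from the open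
mapping theorem (`isClosed_map_of_finiteDimensional_quotient_range`).

Conversely, let `p` be an exponent at which the kernels `N(A^p)` are stable and `q` one at which the
ranges `R(B^q)` are. Modulo the finite-dimensional space `N(A^p)` the operator `A` is injective, with
a cokernel of dimension `β(A) - α(A)` (`extDim_quotient_range_eq_add`); on the space `R(B^q)`, which
has finite codimension, `B` is surjective, with a kernel of dimension `α(B) - β(B)`
(`extDim_ker_eq_add`). The index condition says that these two dimensions agree, so by separability
an isomorphism of this kernel with the orthogonal complement of `R(A) + N(A^p)` exists. Taking it for
`C` makes `M_C` bijective on `(H ⊕ R(B^q)) ⧸ N(A^p)`, while `M_C` is nilpotent on the two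
finite-dimensional pieces that are left out; this forces `M_C` to be Browder
(`exists_stable_of_bijective_subquotient`).
-/

namespace BrowderSpectrum

open Submodule

/-! ### Dimensions in `{0, 1, 2, …, ∞}` -/

section Dimension

variable {k : Type*} [Field k]
variable {V : Type*} [AddCommGroup V] [Module k V]
variable {W : Type*} [AddCommGroup W] [Module k W]

variable (k V) in
/-- The dimension of a vector space as an extended natural number, all infinite dimensions being
identified; unlike `Module.rank` it compares spaces in different universes. -/
noncomputable def extDim : ℕ∞ := Cardinal.toENat (Module.rank k V)

theorem extDim_lt_top_iff : extDim k V < ⊤ ↔ FiniteDimensional k V := by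
  rw [extDim, Cardinal.toENat_lt_top, Module.rank_lt_aleph0_iff]

theorem extDim_ne_top [FiniteDimensional k V] : extDim k V ≠ ⊤ :=
  (extDim_lt_top_iff.2 inferInstance).ne

theorem _root_.LinearEquiv.extDim_eq (e : V ≃ₗ[k] W) : extDim k V = extDim k W := by
  rw [extDim, extDim, ← Cardinal.toENat_lift, e.lift_rank_eq, Cardinal.toENat_lift]

theorem extDim_quotient_add_extDim (N : Submodule k V) :
    extDim k (V ⧸ N) + extDim k N = extDim k V := by
  rw [extDim, extDim, extDim, ← map_add, rank_quotient_add_rank]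

theorem extDim_range_add_extDim_ker (f : V →ₗ[k] W) :
    extDim k (LinearMap.range f) + extDim k (LinearMap.ker f) = extDim k V := by
  rw [← f.quotKerEquivRange.extDim_eq, extDim_quotient_add_extDim]

theorem extDim_map_add_extDim_inf_ker (f : V →ₗ[k] W) (N : Submodule k V) :
    extDim k (N.map f) + extDim k (N ⊓ LinearMap.ker f : Submodule k V) = extDim k N := by
  rw [← extDim_range_add_extDim_ker (f.domRestrict N), LinearMap.range_domRestrict,
    LinearMap.ker_domRestrict, ← (comapSubtypeEquivOfLe
      (inf_le_left : N ⊓ LinearMap.ker f ≤ N)).extDim_eq, comap_inf, comap_subtype_self,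
    top_inf_eq]

theorem extDim_map_of_disjoint (f : V →ₗ[k] W) (N : Submodule k V)
    (h : Disjoint N (LinearMap.ker f)) : extDim k (N.map f) = extDim k N := by
  have h' := extDim_map_add_extDim_inf_ker f N
  rw [h.eq_bot] at h'
  simpa [extDim] using h'

theorem extDim_quotient_quotient_map (R N : Submodule k V) :
    extDim k ((V ⧸ R) ⧸ N.map R.mkQ) = extDim k (V ⧸ R ⊔ N) :=
  (quotientQuotientEquivQuotientSup R N).extDim_eq

theorem extDim_quotient_sup_add_extDim_map (R N : Submodule k V) :
    extDim k (V ⧸ R ⊔ N) + extDim k (N.map R.mkQ) = extDim k (V ⧸ R) := by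
  rw [← extDim_quotient_quotient_map, extDim_quotient_add_extDim]

/-- On a finite-dimensional space kernel and cokernel have the same dimension. -/
theorem extDim_ker_eq_extDim_quotient_range [FiniteDimensional k V] (f : V →ₗ[k] V) :
    extDim k (LinearMap.ker f) = extDim k (V ⧸ LinearMap.range f) := by
  have h := (extDim_range_add_extDim_ker f).trans
    ((extDim_quotient_add_extDim (LinearMap.range f)).symm.trans (add_comm _ _))
  exact ENat.add_right_injective_of_ne_top extDim_ne_top h

end Dimension

/-! ### Kernels and ranges of the powers of a linear map -/

section Stabilization

variable {k : Type*} [Field k] {V : Type*} [AddCommGroup V] [Module k V] {T : V →ₗ[k] V}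

theorem pow_apply_eq_zero_of_ker_pow_eq {p : ℕ}
    (hp : LinearMap.ker (T ^ p) = LinearMap.ker (T ^ (p + 1))) (m : ℕ) {x : V}
    (hx : (T ^ (m + p)) x = 0) : (T ^ p) x = 0 := by
  induction m generalizing x with
  | zero => simpa using hx
  | succ m ih =>
    have h1 : (T ^ (m + p)) (T x) = 0 := by
      rw [← Module.End.mul_apply, ← pow_succ]
      rwa [show m + p + 1 = m + 1 + p by ring]
    have h2 : T x ∈ LinearMap.ker (T ^ p) := ih h1
    have h3 : x ∈ LinearMap.ker (T ^ (p + 1)) := by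
      rw [LinearMap.mem_ker] at h2 ⊢
      rwa [pow_succ, Module.End.mul_apply]
    rw [← hp] at h3
    exact h3

theorem exists_pow_apply_eq_of_range_pow_eq {q : ℕ}
    (hq : LinearMap.range (T ^ q) = LinearMap.range (T ^ (q + 1))) (m : ℕ) (x : V) :
    ∃ y, (T ^ (m + q)) y = (T ^ q) x := by
  induction m with
  | zero => exact ⟨x, by simp⟩
  | succ m ih =>
    obtain ⟨y, hy⟩ := ih
    have h : (T ^ q) y ∈ LinearMap.range (T ^ (q + 1)) := hq ▸ LinearMap.mem_range_self _ y
    obtain ⟨z, hz⟩ := h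
    refine ⟨z, ?_⟩
    rw [show m + 1 + q = m + (q + 1) by ring, pow_add, Module.End.mul_apply, hz,
      ← Module.End.mul_apply, ← pow_add, hy]

/-- If the kernels and the ranges of the powers of `T` both stabilize, the ranges are stable from
each exponent on at which the kernels are. -/
theorem range_pow_eq_of_ker_pow_eq {p q : ℕ}
    (hp : LinearMap.ker (T ^ p) = LinearMap.ker (T ^ (p + 1)))
    (hq : LinearMap.range (T ^ q) = LinearMap.range (T ^ (q + 1))) :
    LinearMap.range (T ^ p) = LinearMap.range (T ^ (p + 1)) := by
  apply le_antisymm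
  · rintro _ ⟨x, rfl⟩
    obtain ⟨y, hy⟩ := exists_pow_apply_eq_of_range_pow_eq hq 1 x
    have h : (T ^ (q + p)) (x - T y) = 0 := by
      rw [add_comm q p, pow_add, Module.End.mul_apply, map_sub, ← hy, ← Module.End.mul_apply _ T,
        ← pow_succ, add_comm 1 q, sub_self, map_zero]
    have h' := pow_apply_eq_zero_of_ker_pow_eq hp q h
    rw [map_sub, sub_eq_zero, ← Module.End.mul_apply, ← pow_succ] at h'
    exact ⟨y, h'.symm⟩
  · rw [pow_succ]
    exact LinearMap.range_comp_le_range _ _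

/-- If the kernels and the ranges of the powers of `T` both stabilize, the kernels are stable from
each exponent on at which the ranges are. -/
theorem ker_pow_eq_of_range_pow_eq {p q : ℕ}
    (hp : LinearMap.ker (T ^ p) = LinearMap.ker (T ^ (p + 1)))
    (hq : LinearMap.range (T ^ q) = LinearMap.range (T ^ (q + 1))) :
    LinearMap.ker (T ^ q) = LinearMap.ker (T ^ (q + 1)) := by
  apply le_antisymm
  · rw [pow_succ']
    exact LinearMap.ker_le_ker_comp _ _
  · intro x hx
    rw [LinearMap.mem_ker] at hx ⊢
    obtain ⟨y, hy⟩ := exists_pow_apply_eq_of_range_pow_eq hq p x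
    rw [pow_succ', Module.End.mul_apply, ← hy, ← Module.End.mul_apply, ← pow_succ',
      show p + q + 1 = (q + 1) + p by ring] at hx
    have h := pow_apply_eq_zero_of_ker_pow_eq hp (q + 1) hx
    rw [← hy, add_comm p q, pow_add, Module.End.mul_apply, h, map_zero]

theorem finiteDimensional_ker_pow [FiniteDimensional k (LinearMap.ker T)] (n : ℕ) :
    FiniteDimensional k (LinearMap.ker (T ^ n)) := by
  induction n with
  | zero =>
    rw [pow_zero, Module.End.one_eq_id, LinearMap.ker_id]
    infer_instance
  | succ n ih =>
    rw [pow_succ, Module.End.mul_eq_comp, LinearMap.ker_comp]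
    infer_instance

theorem finiteDimensional_quotient_range_pow [FiniteDimensional k (V ⧸ LinearMap.range T)] (n : ℕ) :
    FiniteDimensional k (V ⧸ LinearMap.range (T ^ n)) := by
  induction n with
  | zero =>
    rw [pow_zero, Module.End.one_eq_id, LinearMap.range_id]
    infer_instance
  | succ n ih =>
    rw [pow_succ', Module.End.mul_eq_comp, LinearMap.range_comp]
    infer_instance

/-- If `ker T ^ p = ker T ^ (p + 1)` is finite-dimensional, `T` induces an injective operator on
the quotient by it, whose cokernel `V ⧸ (R(T) + ker T ^ p)` accounts for the difference between the
nullity and the defect of `T`. -/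
theorem extDim_quotient_range_eq_add [FiniteDimensional k (LinearMap.ker T)] {p : ℕ}
    (hp : LinearMap.ker (T ^ p) = LinearMap.ker (T ^ (p + 1))) :
    extDim k (V ⧸ LinearMap.range T) = extDim k (LinearMap.ker T) +
      extDim k (V ⧸ LinearMap.range T ⊔ LinearMap.ker (T ^ p)) := by
  have hfin : FiniteDimensional k (LinearMap.ker (T ^ p)) := finiteDimensional_ker_pow p
  set N := LinearMap.ker (T ^ p) with hN
  have hker : LinearMap.ker T ≤ N := by
    intro x hx
    refine pow_apply_eq_zero_of_ker_pow_eq hp 1 ?_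
    rw [add_comm, pow_succ, Module.End.mul_apply, LinearMap.mem_ker.1 hx, map_zero]
  have hmap : N.map T = N ⊓ LinearMap.range T := by
    apply le_antisymm
    · rintro _ ⟨x, hx, rfl⟩
      refine ⟨?_, LinearMap.mem_range_self _ _⟩
      change (T ^ p) (T x) = 0
      rw [← Module.End.mul_apply, ← pow_succ, pow_succ', Module.End.mul_apply,
        LinearMap.mem_ker.1 hx, map_zero]
    · rintro _ ⟨hx, x, rfl⟩
      refine mem_map_of_mem (pow_apply_eq_zero_of_ker_pow_eq hp 1 ?_)
      rw [add_comm, pow_succ, Module.End.mul_apply]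
      exact hx
  have h1 := extDim_map_add_extDim_inf_ker T N
  rw [hmap, inf_eq_right.2 hker] at h1
  have h2 := extDim_map_add_extDim_inf_ker (LinearMap.range T).mkQ N
  rw [ker_mkQ, ← h1, add_comm] at h2
  have hfin' : FiniteDimensional k (N ⊓ LinearMap.range T : Submodule k V) :=
    finiteDimensional_of_le inf_le_left
  rw [← ENat.add_right_injective_of_ne_top extDim_ne_top h2, add_comm,
    extDim_quotient_sup_add_extDim_map]

/-- If `R(T ^ q) = R(T ^ (q + 1))` has finite codimension, `T` restricts to a surjective operator
on it, whose kernel accounts for the difference between the defect and the nullity of `T`. -/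
theorem extDim_ker_eq_add [FiniteDimensional k (V ⧸ LinearMap.range T)] {q : ℕ}
    (hq : LinearMap.range (T ^ q) = LinearMap.range (T ^ (q + 1))) :
    extDim k (LinearMap.ker T) = extDim k (V ⧸ LinearMap.range T) +
      extDim k (LinearMap.ker T ⊓ LinearMap.range (T ^ q) : Submodule k V) := by
  have hfin : FiniteDimensional k (V ⧸ LinearMap.range (T ^ q)) :=
    finiteDimensional_quotient_range_pow q
  have hle : LinearMap.range (T ^ q) ≤ LinearMap.range T := by
    rw [hq, pow_succ']
    exact LinearMap.range_comp_le_range _ _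
  have hsurj : ∀ x ∈ LinearMap.range (T ^ q), ∃ y ∈ LinearMap.range (T ^ q), T y = x := by
    intro x hx
    rw [hq] at hx
    obtain ⟨y, rfl⟩ := hx
    exact ⟨(T ^ q) y, LinearMap.mem_range_self _ _, by
      rw [pow_succ', Module.End.mul_apply]⟩
  have hinv : LinearMap.range (T ^ q) ≤ (LinearMap.range (T ^ q)).comap T := by
    rintro _ ⟨y, rfl⟩
    refine ⟨T y, ?_⟩
    rw [← Module.End.mul_apply, ← Module.End.mul_apply, ← pow_succ, ← pow_succ']
  set R := LinearMap.range (T ^ q) with hR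
  have h1 := extDim_map_add_extDim_inf_ker R.mkQ (LinearMap.ker T)
  have hker : (LinearMap.ker T).map R.mkQ = LinearMap.ker (R.mapQ R T hinv) := by
    rw [ker_mapQ]
    apply le_antisymm
    · refine map_mono fun x hx => ?_
      rw [mem_comap, LinearMap.mem_ker.1 hx]
      exact R.zero_mem
    · rintro _ ⟨x, hx, rfl⟩
      obtain ⟨y, hy, hyx⟩ := hsurj _ hx
      refine ⟨x - y, by simp [hyx], ?_⟩
      rw [map_sub, mkQ_apply R y, (Quotient.mk_eq_zero R).2 hy, sub_zero]
  rw [ker_mkQ, hker, extDim_ker_eq_extDim_quotient_range, range_mapQ, extDim_quotient_quotient_map,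
    sup_eq_right.2 hle] at h1
  exact h1.symm

/-- A Fredholm operator with finite ascent and descent has index zero. -/
theorem extDim_ker_eq_extDim_quotient_range_of_stable [FiniteDimensional k (LinearMap.ker T)]
    {p q : ℕ} (hp : LinearMap.ker (T ^ p) = LinearMap.ker (T ^ (p + 1)))
    (hq : LinearMap.range (T ^ q) = LinearMap.range (T ^ (q + 1))) :
    extDim k (LinearMap.ker T) = extDim k (V ⧸ LinearMap.range T) := by
  have htop : LinearMap.range T ⊔ LinearMap.ker (T ^ p) = ⊤ := by
    refine eq_top_iff.2 fun x _ => ?_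
    obtain ⟨y, hy⟩ := exists_pow_apply_eq_of_range_pow_eq (range_pow_eq_of_ker_pow_eq hp hq) 1 x
    refine mem_sup.2 ⟨T y, LinearMap.mem_range_self _ _, x - T y, ?_, by abel⟩
    rw [LinearMap.mem_ker, map_sub, ← hy, ← Module.End.mul_apply, ← pow_succ, add_comm, sub_self]
  rw [extDim_quotient_range_eq_add hp, htop]
  simp [extDim]

/-- Let `N ≤ R` be subspaces, `N` finite-dimensional and `R` of finite codimension, such that `T`
is nilpotent on `N` and on `V ⧸ R` and induces a bijective operator on `R ⧸ N`. Then `T` is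
Fredholm, and the kernels and the ranges of its powers stabilize. -/
theorem exists_stable_of_bijective_subquotient {N R : Submodule k V} [FiniteDimensional k N]
    [FiniteDimensional k (V ⧸ R)] {p q : ℕ} (hN : ∀ x ∈ N, (T ^ p) x = 0)
    (hR : ∀ x, (T ^ q) x ∈ R) (hmaps : ∀ x ∈ R, T x ∈ R) (hinj : ∀ x ∈ R, T x ∈ N → x ∈ N)
    (hsurj : R ≤ R.map T ⊔ N) :
    FiniteDimensional k (LinearMap.ker T) ∧ FiniteDimensional k (V ⧸ LinearMap.range T) ∧
      ∃ n, LinearMap.ker (T ^ n) = LinearMap.ker (T ^ (n + 1)) ∧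
        LinearMap.range (T ^ n) = LinearMap.range (T ^ (n + 1)) := by
  have hpow : ∀ j, ∀ x ∈ R, (T ^ j) x = 0 → x ∈ N := by
    intro j
    induction j with
    | zero =>
      intro x _ hx
      have : x = 0 := by simpa using hx
      exact this ▸ N.zero_mem
    | succ j ih =>
      intro x hx h
      refine hinj x hx (ih _ (hmaps x hx) ?_)
      rwa [pow_succ, Module.End.mul_apply] at h
  refine ⟨?_, ?_, p + q, ?_, ?_⟩
  · rw [← extDim_lt_top_iff, ← extDim_map_add_extDim_inf_ker R.mkQ (LinearMap.ker T)]
    have hle : LinearMap.ker T ⊓ LinearMap.ker R.mkQ ≤ N := by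
      rw [ker_mkQ]
      rintro x ⟨hx, hxR⟩
      exact hpow 1 x hxR (by simpa using hx)
    have hfin := finiteDimensional_of_le hle
    exact ENat.add_lt_top.2 ⟨extDim_lt_top_iff.2 inferInstance, extDim_lt_top_iff.2 inferInstance⟩
  · rw [← extDim_lt_top_iff, ← extDim_quotient_sup_add_extDim_map (LinearMap.range T) N]
    have hle : R ≤ LinearMap.range T ⊔ N :=
      hsurj.trans (sup_le_sup_right LinearMap.map_le_range _)
    have hfin : FiniteDimensional k (V ⧸ LinearMap.range T ⊔ N) :=
      CoFG.of_le hle inferInstance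
    exact ENat.add_lt_top.2 ⟨extDim_lt_top_iff.2 hfin, extDim_lt_top_iff.2 inferInstance⟩
  · apply le_antisymm
    · rw [pow_succ']
      exact LinearMap.ker_le_ker_comp _ _
    · intro x hx
      rw [LinearMap.mem_ker] at hx ⊢
      rw [show p + q + 1 = (p + 1) + q by ring, pow_add, Module.End.mul_apply] at hx
      rw [pow_add, Module.End.mul_apply]
      exact hN _ (hpow _ _ (hR x) hx)
  · apply le_antisymm
    · rintro _ ⟨x, rfl⟩
      have hstep : ∀ j, ∀ y ∈ R, ∃ z ∈ R, (T ^ p) y = (T ^ (p + j)) z := by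
        intro j
        induction j with
        | zero => exact fun y hy => ⟨y, hy, rfl⟩
        | succ j ih =>
          intro y hy
          obtain ⟨z, hz, hyz⟩ := ih y hy
          obtain ⟨_, ⟨w, hw, rfl⟩, n, hn, hwn⟩ := mem_sup.1 (hsurj hz)
          refine ⟨w, hw, ?_⟩
          rw [hyz, ← hwn, map_add, add_comm p j, pow_add (n := p), Module.End.mul_apply _ _ n,
            hN n hn, map_zero, add_zero, ← pow_add, ← Module.End.mul_apply, ← pow_succ]
          congr 2
          ring
      obtain ⟨z, -, hz⟩ := hstep (q + 1) _ (hR x)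
      exact ⟨z, by rw [add_assoc, ← hz, pow_add, Module.End.mul_apply]⟩
    · rw [pow_succ]
      exact LinearMap.range_comp_le_range _ _

end Stabilization

/-! ### Closed ranges -/

section Closed

variable {E F : Type*} [NormedAddCommGroup E] [NormedSpace ℂ E] [CompleteSpace E]
  [NormedAddCommGroup F] [NormedSpace ℂ F] [CompleteSpace F]

/-- The image of a subspace `S` under an operator `T` whose range has finite codimension is closed
as soon as `S + N(T)` is. Indeed, if `G` is a finite-dimensional complement of the range, then
`(x, g) ↦ T x + g` is a surjection `E × G → F` of Banach spaces, hence a quotient map, and the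
preimage of `T S` is `(S + N(T)) × 0`. -/
theorem isClosed_map_of_finiteDimensional_quotient_range (T : E →L[ℂ] F)
    [FiniteDimensional ℂ (F ⧸ LinearMap.range (T : E →ₗ[ℂ] F))] (S : Submodule ℂ E)
    (hS : IsClosed ((S ⊔ LinearMap.ker (T : E →ₗ[ℂ] F) : Submodule ℂ E) : Set E)) :
    IsClosed (S.map (T : E →ₗ[ℂ] F) : Set F) := by
  obtain ⟨G, hG⟩ := Submodule.exists_isCompl (LinearMap.range (T : E →ₗ[ℂ] F))
  have hGfin : FiniteDimensional ℂ G := .of_fg <| CoFG.fg_of_isCompl hG inferInstance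
  have hGcomplete : CompleteSpace G := FiniteDimensional.complete ℂ G
  let ψ : E × G →L[ℂ] F := T.coprod G.subtypeL
  have hψ : Function.Surjective ψ := by
    intro y
    obtain ⟨_, ⟨x, rfl⟩, g, hg, hxg⟩ := mem_sup.1 (hG.sup_eq_top ▸ mem_top : y ∈ _ ⊔ G)
    exact ⟨(x, ⟨g, hg⟩), by simpa [ψ] using hxg⟩
  rw [← (ψ.isQuotientMap hψ).isClosed_preimage]
  have hpre : ψ ⁻¹' (S.map (T : E →ₗ[ℂ] F) : Set F) =
      ((S ⊔ LinearMap.ker (T : E →ₗ[ℂ] F) : Submodule ℂ E) : Set E) ×ˢ {0} := by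
    ext ⟨x, g⟩
    simp only [Set.mem_preimage, SetLike.mem_coe, Set.mem_prod, Set.mem_singleton_iff]
    constructor
    · rintro ⟨s, hs, hsx⟩
      replace hsx : T s = T x + g := by simpa [ψ] using hsx
      have hg : (g : F) = 0 := by
        refine (disjoint_def.1 hG.disjoint) g ⟨s - x, ?_⟩ g.2
        simp [hsx]
      refine ⟨mem_sup.2 ⟨s, hs, x - s, ?_, by abel⟩, Subtype.ext hg⟩
      simp [hsx, hg]
    · rintro ⟨hx, rfl⟩
      obtain ⟨s, hs, n, hn, rfl⟩ := mem_sup.1 hx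
      refine ⟨s, hs, ?_⟩
      have : T n = 0 := hn
      simp [ψ, this]
  rw [hpre]
  exact hS.prod isClosed_singleton

theorem isClosed_range_of_finiteDimensional_quotient_range (T : E →L[ℂ] F)
    [FiniteDimensional ℂ (F ⧸ LinearMap.range (T : E →ₗ[ℂ] F))] :
    IsClosed (LinearMap.range (T : E →ₗ[ℂ] F) : Set F) := by
  have h := isClosed_map_of_finiteDimensional_quotient_range T ⊤ (by simp)
  rwa [Submodule.map_top] at h

end Closed

/-! ### Separable Hilbert spaces of equal dimension -/

section Hilbert

theorem _root_.Orthonormal.countable_of_separableSpace {E : Type*} [NormedAddCommGroup E]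
    [InnerProductSpace ℂ E] [TopologicalSpace.SeparableSpace E] {ι : Type*} {v : ι → E}
    (hv : Orthonormal ℂ v) : Countable ι := by
  -- Orthonormal vectors have distance `√2`, so the balls of radius `1 / 2` around them are disjoint.
  refine Pairwise.countable_of_isOpen_disjoint (s := fun i => Metric.ball (v i) (1 / 2)) ?_
    (fun i => Metric.isOpen_ball) (fun i => ⟨v i, Metric.mem_ball_self (by norm_num)⟩)
  intro i j hij
  refine Metric.ball_disjoint_ball ?_
  have h : ‖v i - v j‖ * ‖v i - v j‖ = 2 := by
    rw [← sq, norm_sub_sq (𝕜 := ℂ), hv.1 i, hv.1 j, hv.2 hij]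
    norm_num
  rw [dist_eq_norm]
  nlinarith [norm_nonneg (v i - v j)]

variable {E F : Type*} [NormedAddCommGroup E] [InnerProductSpace ℂ E] [CompleteSpace E]
  [TopologicalSpace.SeparableSpace E]
  [NormedAddCommGroup F] [InnerProductSpace ℂ F] [CompleteSpace F]
  [TopologicalSpace.SeparableSpace F]

theorem exists_hilbertBasis_nat (h : ¬ FiniteDimensional ℂ E) :
    Nonempty (HilbertBasis ℕ ℂ E) := by
  obtain ⟨w, b, -⟩ := exists_hilbertBasis ℂ E
  have hc : Countable w := b.orthonormal.countable_of_separableSpace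
  have hi : Infinite w := by
    by_contra hw
    have hfin : Finite w := not_infinite_iff_finite.1 hw
    have hspan : FiniteDimensional ℂ (span ℂ (Set.range b)) :=
      FiniteDimensional.span_of_finite ℂ (Set.finite_range b)
    have htop := b.dense_span
    rw [(span ℂ (Set.range b)).closed_of_finiteDimensional.submodule_topologicalClosure_eq] at htop
    rw [htop] at hspan
    exact h (Module.Finite.equiv (topEquiv (R := ℂ) (M := E)))
  obtain ⟨e⟩ := nonempty_equiv_of_countable (α := ℕ) (β := w)
  exact ⟨HilbertBasis.mk (v := b ∘ e) (b.orthonormal.comp e e.injective)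
    (by rw [e.surjective.range_comp, b.dense_span])⟩

/-- Separable Hilbert spaces of the same dimension in `{0, 1, 2, …, ∞}` are isomorphic. -/
theorem nonempty_continuousLinearEquiv_of_extDim_eq (h : extDim ℂ E = extDim ℂ F) :
    Nonempty (E ≃L[ℂ] F) := by
  by_cases hE : FiniteDimensional ℂ E
  · have hF : FiniteDimensional ℂ F := extDim_lt_top_iff.1 (h ▸ extDim_lt_top_iff.2 hE)
    apply FiniteDimensional.nonempty_continuousLinearEquiv_of_finrank_eq
    rw [Module.finrank, Module.finrank, ← Cardinal.toNat_toENat, ← Cardinal.toNat_toENat]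
    exact congrArg ENat.toNat h
  · have hF : ¬ FiniteDimensional ℂ F := fun hF =>
      hE (extDim_lt_top_iff.1 (h.symm ▸ extDim_lt_top_iff.2 hF))
    obtain ⟨b⟩ := exists_hilbertBasis_nat hE
    obtain ⟨c⟩ := exists_hilbertBasis_nat hF
    exact ⟨(b.repr.trans c.repr.symm).toContinuousLinearEquiv⟩

end Hilbert

/-! ### Ascent, descent and Browder operators -/

section AscentDescent

variable {X : Type*} [NormedAddCommGroup X] [NormedSpace ℂ X] {T : X →L[ℂ] X}

theorem ascent_lt_top_iff : ascent T < ⊤ ↔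
    ∃ p, LinearMap.ker ((T : X →ₗ[ℂ] X) ^ p) = LinearMap.ker ((T : X →ₗ[ℂ] X) ^ (p + 1)) := by
  simp only [ascent, sInf_lt_iff, ContinuousLinearMap.toLinearMap_pow]
  constructor
  · rintro ⟨_, ⟨p, -, hp⟩, -⟩
    exact ⟨p, hp⟩
  · rintro ⟨p, hp⟩
    exact ⟨p, ⟨p, rfl, hp⟩, ENat.natCast_lt_top p⟩

theorem descent_lt_top_iff : descent T < ⊤ ↔
    ∃ q, LinearMap.range ((T : X →ₗ[ℂ] X) ^ q) = LinearMap.range ((T : X →ₗ[ℂ] X) ^ (q + 1)) := by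
  simp only [descent, sInf_lt_iff, ContinuousLinearMap.toLinearMap_pow]
  constructor
  · rintro ⟨_, ⟨p, -, hp⟩, -⟩
    exact ⟨p, hp⟩
  · rintro ⟨p, hp⟩
    exact ⟨p, ⟨p, rfl, hp⟩, ENat.natCast_lt_top p⟩

/-- If the ascent and the descent are both finite, they are equal. -/
theorem ascent_eq_descent (ha : ascent T < ⊤) (hd : descent T < ⊤) : ascent T = descent T := by
  obtain ⟨p, hp⟩ := ascent_lt_top_iff.1 ha
  obtain ⟨q, hq⟩ := descent_lt_top_iff.1 hd
  simp only [ascent, descent, ContinuousLinearMap.toLinearMap_pow]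
  congr 1
  ext m
  constructor
  · rintro ⟨n, rfl, hn⟩
    exact ⟨n, rfl, range_pow_eq_of_ker_pow_eq hn hq⟩
  · rintro ⟨n, rfl, hn⟩
    exact ⟨n, rfl, ker_pow_eq_of_range_pow_eq hp hn⟩

theorem isFredholm_iff : IsFredholm T ↔
    FiniteDimensional ℂ (LinearMap.ker (T : X →ₗ[ℂ] X)) ∧
      FiniteDimensional ℂ (X ⧸ LinearMap.range (T : X →ₗ[ℂ] X)) := by
  rw [← extDim_lt_top_iff, ← extDim_lt_top_iff]
  rfl

theorem isBrowder_iff : IsBrowder T ↔ IsFredholm T ∧ ascent T < ⊤ ∧ descent T < ⊤ :=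
  ⟨fun h => ⟨h.1, h.2.1 ▸ h.2.2, h.2.2⟩, fun h => ⟨h.1, ascent_eq_descent h.2.1 h.2.2, h.2.2⟩⟩

/-- The operator form of `exists_stable_of_bijective_subquotient`. -/
theorem isBrowder_of_bijective_subquotient {N R : Submodule ℂ X} [FiniteDimensional ℂ N]
    [FiniteDimensional ℂ (X ⧸ R)] {p q : ℕ} (hN : ∀ x ∈ N, ((T : X →ₗ[ℂ] X) ^ p) x = 0)
    (hR : ∀ x, ((T : X →ₗ[ℂ] X) ^ q) x ∈ R) (hmaps : ∀ x ∈ R, T x ∈ R)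
    (hinj : ∀ x ∈ R, T x ∈ N → x ∈ N) (hsurj : R ≤ R.map (T : X →ₗ[ℂ] X) ⊔ N) :
    IsBrowder T := by
  obtain ⟨h1, h2, n, h3, h4⟩ := exists_stable_of_bijective_subquotient hN hR hmaps hinj hsurj
  exact isBrowder_iff.2 ⟨isFredholm_iff.2 ⟨h1, h2⟩, ascent_lt_top_iff.2 ⟨n, h3⟩,
    descent_lt_top_iff.2 ⟨n, h4⟩⟩

end AscentDescent

/-! ### Upper triangular operator matrices -/

section Matrices

variable {H K : Type*} [NormedAddCommGroup H] [InnerProductSpace ℂ H]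
  [NormedAddCommGroup K] [InnerProductSpace ℂ K]
  {A : H →L[ℂ] H} {B : K →L[ℂ] K} {C : K →L[ℂ] H}

theorem upperTriangular_apply (v : WithLp 2 (H × K)) :
    upperTriangular A B C v = WithLp.toLp 2 (A v.fst + C v.snd, B v.snd) := rfl

theorem shift_upperTriangular (l : ℂ) :
    shift (upperTriangular A B C) l = upperTriangular (shift A l) (shift B l) C := by
  ext1 v
  refine WithLp.ofLp_injective 2 (Prod.ext ?_ ?_)
  · change A v.fst + C v.snd - l • v.fst = A v.fst - l • v.fst + C v.snd
    abel
  · rfl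

variable (H K) in
/-- The inclusion of the first summand into the Hilbert space direct sum `H ⊕ K`. -/
noncomputable def inlL : H →L[ℂ] WithLp 2 (H × K) :=
  ((WithLp.prodContinuousLinearEquiv 2 ℂ H K).symm : H × K →L[ℂ] WithLp 2 (H × K)) ∘L
    ContinuousLinearMap.inl ℂ H K

theorem inlL_apply (x : H) : inlL H K x = WithLp.toLp 2 (x, 0) := rfl

theorem inlL_injective : Function.Injective (inlL H K) := fun _ _ h =>
  congrArg (fun v : WithLp 2 (H × K) => v.fst) h

theorem range_inlL : LinearMap.range (inlL H K : H →ₗ[ℂ] WithLp 2 (H × K)) =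
    LinearMap.ker (WithLp.sndL 2 ℂ H K : WithLp 2 (H × K) →ₗ[ℂ] K) := by
  ext v
  constructor
  · rintro ⟨x, rfl⟩
    rfl
  · intro hv
    replace hv : v.snd = 0 := hv
    exact ⟨v.fst, WithLp.ofLp_injective 2 (Prod.ext rfl hv.symm)⟩

theorem upperTriangular_pow_inlL (n : ℕ) (x : H) :
    ((upperTriangular A B C : WithLp 2 (H × K) →ₗ[ℂ] WithLp 2 (H × K)) ^ n) (inlL H K x) =
      inlL H K (((A : H →ₗ[ℂ] H) ^ n) x) := by
  induction n generalizing x with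
  | zero => rfl
  | succ n ih =>
    have h : upperTriangular A B C (inlL H K x) = inlL H K (A x) := by
      simp [upperTriangular_apply, inlL_apply]
    rw [pow_succ, Module.End.mul_apply, pow_succ, Module.End.mul_apply,
      ContinuousLinearMap.coe_coe, h, ih, ContinuousLinearMap.coe_coe]

theorem upperTriangular_pow_snd (n : ℕ) (v : WithLp 2 (H × K)) :
    (((upperTriangular A B C : WithLp 2 (H × K) →ₗ[ℂ] WithLp 2 (H × K)) ^ n) v).snd =
      ((B : K →ₗ[ℂ] K) ^ n) v.snd := by
  induction n generalizing v with
  | zero => rfl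
  | succ n ih =>
    rw [pow_succ, Module.End.mul_apply, pow_succ, Module.End.mul_apply, ih]
    rfl

/-- The dimension count of the snake lemma for `M_C`: with the connecting map
`N(B) → H ⧸ R(A)`, `y ↦ C y + R(A)`, there is an exact sequence
`0 → N(A) → N(M_C) → N(B) → H ⧸ R(A) → (H ⊕ K) ⧸ R(M_C) → K ⧸ R(B) → 0`. The numbers `d`, `r`, `c`
are the dimensions of the kernel, the range and the cokernel of the connecting map. -/
theorem exists_nullity_defect_upperTriangular (A : H →L[ℂ] H) (B : K →L[ℂ] K) (C : K →L[ℂ] H) :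
    ∃ d r c : ℕ∞, nullity (upperTriangular A B C) = d + nullity A ∧ nullity B = r + d ∧
      defect A = c + r ∧ defect (upperTriangular A B C) = defect B + c := by
  set a : H →ₗ[ℂ] H := A.toLinearMap
  set b : K →ₗ[ℂ] K := B.toLinearMap
  set M : WithLp 2 (H × K) →ₗ[ℂ] WithLp 2 (H × K) :=
    (upperTriangular A B C).toLinearMap with hM
  set i : H →ₗ[ℂ] WithLp 2 (H × K) := (inlL H K).toLinearMap with hi
  set s : WithLp 2 (H × K) →ₗ[ℂ] K :=
    (WithLp.sndL 2 ℂ H K).toLinearMap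
  set δ : K →ₗ[ℂ] H ⧸ LinearMap.range a := (LinearMap.range a).mkQ ∘ₗ C.toLinearMap with hδ
  set P : Submodule ℂ H := (LinearMap.ker b).map (C : K →ₗ[ℂ] H)
  have hδ0 : ∀ y, δ y = 0 ↔ ∃ x, A x = C y := fun y =>
    Quotient.mk_eq_zero (LinearMap.range a)
  have hMi : ∀ x, M (i x) = i (A x) := fun x => upperTriangular_pow_inlL (n := 1) x
  refine ⟨extDim ℂ (LinearMap.ker b ⊓ LinearMap.ker δ : Submodule ℂ K),
    extDim ℂ ((LinearMap.ker b).map δ), extDim ℂ (H ⧸ LinearMap.range a ⊔ P), ?_, ?_, ?_, ?_⟩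
  · have h1 : (LinearMap.ker M).map s = LinearMap.ker b ⊓ LinearMap.ker δ := by
      ext y
      constructor
      · rintro ⟨v, hv, rfl⟩
        replace hv : upperTriangular A B C v = 0 := hv
        rw [upperTriangular_apply] at hv
        have h1 : A v.fst + C v.snd = 0 := congrArg (fun v : WithLp 2 (H × K) => v.fst) hv
        have h2 : B v.snd = 0 := congrArg (fun v : WithLp 2 (H × K) => v.snd) hv
        refine ⟨h2, (hδ0 _).2 ⟨-v.fst, ?_⟩⟩
        rw [map_neg]
        exact neg_eq_of_add_eq_zero_right h1
      · rintro ⟨hy, hy'⟩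
        obtain ⟨x, hx⟩ := (hδ0 y).1 hy'
        replace hy : B y = 0 := hy
        refine ⟨WithLp.toLp 2 (-x, y), ?_, rfl⟩
        change upperTriangular A B C _ = 0
        rw [upperTriangular_apply]
        simp [hx, hy]
    have h2 : LinearMap.ker M ⊓ LinearMap.ker s = (LinearMap.ker a).map i := by
      rw [← range_inlL]
      ext v
      constructor
      · rintro ⟨hv, x, rfl⟩
        refine ⟨x, inlL_injective (K := K) ?_, rfl⟩
        rw [map_zero]
        exact (hMi x).symm.trans hv
      · rintro ⟨x, hx, rfl⟩
        refine ⟨?_, LinearMap.mem_range_self _ x⟩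
        change M (i x) = 0
        rw [hMi, show A x = 0 from hx, map_zero]
    have h3 : Disjoint (LinearMap.ker a) (LinearMap.ker i) := by
      rw [LinearMap.ker_eq_bot.2 inlL_injective]
      exact disjoint_bot_right
    have h4 := extDim_map_add_extDim_inf_ker s (LinearMap.ker M)
    rw [h1, h2, extDim_map_of_disjoint i _ h3] at h4
    exact h4.symm
  · exact (extDim_map_add_extDim_inf_ker δ (LinearMap.ker b)).symm
  · rw [hδ, map_comp]
    exact (extDim_quotient_sup_add_extDim_map (LinearMap.range a) P).symm
  · have h1 : LinearMap.ker ((LinearMap.range b).mkQ ∘ₗ s) =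
        LinearMap.range M ⊔ LinearMap.range i := by
      rw [LinearMap.ker_comp, ker_mkQ]
      ext v
      constructor
      · rintro ⟨y, hy⟩
        replace hy : B y = v.snd := hy
        refine mem_sup.2 ⟨M (WithLp.toLp 2 (0, y)), LinearMap.mem_range_self _ _,
          i (v.fst - C y), LinearMap.mem_range_self _ _, ?_⟩
        refine WithLp.ofLp_injective 2 (Prod.ext ?_ ?_)
        · simp [hM, hi, upperTriangular_apply, inlL_apply]
        · simp [hM, hi, upperTriangular_apply, inlL_apply, hy]
      · intro hv
        obtain ⟨_, ⟨w, rfl⟩, _, ⟨x, rfl⟩, rfl⟩ := mem_sup.1 hv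
        refine ⟨w.snd, ?_⟩
        change B w.snd = B w.snd + 0
        rw [add_zero]
    have hsurj : Function.Surjective ((LinearMap.range b).mkQ ∘ₗ s) :=
      (mkQ_surjective _).comp fun y => ⟨WithLp.toLp 2 (0, y), rfl⟩
    have h2 : LinearMap.ker ((LinearMap.range M).mkQ ∘ₗ i) = LinearMap.range a ⊔ P := by
      rw [LinearMap.ker_comp, ker_mkQ]
      ext x
      constructor
      · rintro ⟨v, hv⟩
        replace hv : upperTriangular A B C v = inlL H K x := hv
        rw [upperTriangular_apply] at hv
        have h1 : A v.fst + C v.snd = x := congrArg (fun v : WithLp 2 (H × K) => v.fst) hv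
        have h2 : B v.snd = 0 := congrArg (fun v : WithLp 2 (H × K) => v.snd) hv
        exact mem_sup.2 ⟨A v.fst, ⟨v.fst, rfl⟩, C v.snd, ⟨v.snd, h2, rfl⟩, h1⟩
      · intro hx
        obtain ⟨_, ⟨u, rfl⟩, _, ⟨y, hy, rfl⟩, rfl⟩ := mem_sup.1 hx
        replace hy : B y = 0 := hy
        refine ⟨WithLp.toLp 2 (u, y), ?_⟩
        change upperTriangular A B C _ = inlL H K (A u + C y)
        rw [upperTriangular_apply, inlL_apply]
        simp [hy]
    have h3 := extDim_quotient_sup_add_extDim_map (LinearMap.range M) (LinearMap.range i)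
    rw [← h1, ← LinearMap.range_comp, (LinearMap.quotKerEquivOfSurjective _ hsurj).extDim_eq,
      ← (LinearMap.quotKerEquivRange _).extDim_eq, h2] at h3
    exact h3.symm

/-- The range of `A` is the preimage of `M_C (H × 0)`, which is closed since `H × 0` is closed and
`N(M_C)` is finite-dimensional. -/
theorem isClosed_range_of_isFredholm_upperTriangular [CompleteSpace H] [CompleteSpace K]
    (h : IsFredholm (upperTriangular A B C)) :
    IsClosed (LinearMap.range (A : H →ₗ[ℂ] H) : Set H) := by
  obtain ⟨hker, hcoker⟩ := isFredholm_iff.1 h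
  have h1 : IsClosed (LinearMap.range (inlL H K : H →ₗ[ℂ] WithLp 2 (H × K)) :
      Set (WithLp 2 (H × K))) := by
    rw [range_inlL]
    exact (WithLp.sndL 2 ℂ H K).isClosed_ker
  have h2 := isClosed_map_of_finiteDimensional_quotient_range (upperTriangular A B C) _
    (isClosed_sup_finiteDimensional _ (LinearMap.ker (upperTriangular A B C).toLinearMap) h1)
  convert h2.preimage (inlL H K).continuous using 1
  ext x
  constructor
  · rintro ⟨y, rfl⟩
    exact ⟨inlL H K y, LinearMap.mem_range_self _ y, upperTriangular_pow_inlL (n := 1) y⟩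
  · rintro ⟨_, ⟨y, rfl⟩, hy⟩
    exact ⟨y, inlL_injective ((upperTriangular_pow_inlL (n := 1) y).symm.trans hy)⟩

theorem closedComplemented_of_isClosed [CompleteSpace H] {S : Submodule ℂ H}
    (hS : IsClosed (S : Set H)) :
    S.ClosedComplemented := by
  have : CompleteSpace S := hS.completeSpace_coe
  exact ⟨S.orthogonalProjectionOnto, S.orthogonalProjectionOnto_mem_subspace_eq_self⟩

theorem IsBrowder.isLeftSemiBrowder [CompleteSpace H] [CompleteSpace K]
    (h : IsBrowder (upperTriangular A B C)) :
    IsLeftSemiBrowder A := by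
  obtain ⟨hF, ha, -⟩ := isBrowder_iff.1 h
  have hcl := isClosed_range_of_isFredholm_upperTriangular hF
  obtain ⟨d, r, c, hd, -⟩ := exists_nullity_defect_upperTriangular A B C
  refine ⟨⟨hcl, closedComplemented_of_isClosed hcl,
    lt_of_le_of_lt (hd ▸ le_add_self) hF.1⟩, ?_⟩
  rw [ascent_lt_top_iff] at ha ⊢
  obtain ⟨p, hp⟩ := ha
  have key : ∀ n x, x ∈ LinearMap.ker ((A : H →ₗ[ℂ] H) ^ n) ↔ inlL H K x ∈ LinearMap.ker
      ((upperTriangular A B C : WithLp 2 (H × K) →ₗ[ℂ] WithLp 2 (H × K)) ^ n) := by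
    intro n x
    rw [LinearMap.mem_ker, LinearMap.mem_ker, upperTriangular_pow_inlL,
      map_eq_zero_iff _ inlL_injective]
  exact ⟨p, by ext x; rw [key, key, hp]⟩

theorem IsBrowder.isRightSemiBrowder [CompleteSpace K]
    (h : IsBrowder (upperTriangular A B C)) :
    IsRightSemiBrowder B := by
  obtain ⟨hF, -, hde⟩ := isBrowder_iff.1 h
  obtain ⟨d, r, c, -, -, -, hc⟩ := exists_nullity_defect_upperTriangular A B C
  refine ⟨⟨B.isClosed_ker, closedComplemented_of_isClosed B.isClosed_ker,
    lt_of_le_of_lt (hc ▸ le_self_add) hF.2⟩, ?_⟩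
  rw [descent_lt_top_iff] at hde ⊢
  obtain ⟨q, hq⟩ := hde
  have key : ∀ n, LinearMap.range ((B : K →ₗ[ℂ] K) ^ n) = (LinearMap.range
      ((upperTriangular A B C : WithLp 2 (H × K) →ₗ[ℂ] WithLp 2 (H × K)) ^ n)).map
        (WithLp.sndL 2 ℂ H K : WithLp 2 (H × K) →ₗ[ℂ] K) := by
    intro n
    ext y
    constructor
    · rintro ⟨z, rfl⟩
      exact ⟨_, ⟨WithLp.toLp 2 (0, z), rfl⟩, upperTriangular_pow_snd n _⟩
    · rintro ⟨_, ⟨v, rfl⟩, rfl⟩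
      exact ⟨v.snd, (upperTriangular_pow_snd n v).symm⟩
  exact ⟨q, by rw [key, key, hq]⟩

theorem IsBrowder.nullity_add_nullity_eq (h : IsBrowder (upperTriangular A B C)) :
    nullity A + nullity B = defect A + defect B := by
  obtain ⟨hF, ha, hde⟩ := isBrowder_iff.1 h
  obtain ⟨p, hp⟩ := ascent_lt_top_iff.1 ha
  obtain ⟨q, hq⟩ := descent_lt_top_iff.1 hde
  have hfin := (isFredholm_iff.1 hF).1
  have hind : nullity (upperTriangular A B C) = defect (upperTriangular A B C) :=
    extDim_ker_eq_extDim_quotient_range_of_stable hp hq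
  obtain ⟨d, r, c, h1, h2, h3, h4⟩ := exists_nullity_defect_upperTriangular A B C
  rw [h2, h3, add_left_comm, add_comm (nullity A), ← h1, hind, h4]
  abel

/-- The completion of `M_C` to a Browder operator. Let `N(A^p) = N(A^(p+1))` and
`R(B^q) = R(B^(q+1))`. Then `A` is injective modulo `N(A^p)` and `B` maps `R(B^q)` onto itself; the index condition
makes `L = N(B) ∩ R(B^q)` and the orthogonal complement `Q` of `R(A) + N(A^p)` isomorphic, and `C`
is such an isomorphism `L → Q`, extended by zero. Then `M_C` is bijective on
`(H ⊕ R(B^q)) ⧸ N(A^p)`. -/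
theorem exists_isBrowder_upperTriangular [CompleteSpace H] [CompleteSpace K]
    [TopologicalSpace.SeparableSpace H] [TopologicalSpace.SeparableSpace K]
    (hA : IsLeftSemiBrowder A) (hB : IsRightSemiBrowder B)
    (hAB : nullity A + nullity B = defect A + defect B) :
    ∃ C : K →L[ℂ] H, IsBrowder (upperTriangular A B C) := by
  obtain ⟨⟨hAcl, -, hAα⟩, hAasc⟩ := hA
  obtain ⟨⟨-, -, hBβ⟩, hBdes⟩ := hB
  obtain ⟨p, hp⟩ := ascent_lt_top_iff.1 hAasc
  obtain ⟨q, hq⟩ := descent_lt_top_iff.1 hBdes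
  have hAfin : FiniteDimensional ℂ (LinearMap.ker (A : H →ₗ[ℂ] H)) := extDim_lt_top_iff.1 hAα
  have hBfin : FiniteDimensional ℂ (K ⧸ LinearMap.range (B : K →ₗ[ℂ] K)) :=
    extDim_lt_top_iff.1 hBβ
  have hHfin : FiniteDimensional ℂ (LinearMap.ker ((A : H →ₗ[ℂ] H) ^ p)) :=
    finiteDimensional_ker_pow p
  have hKfin : FiniteDimensional ℂ (K ⧸ LinearMap.range ((B : K →ₗ[ℂ] K) ^ q)) :=
    finiteDimensional_quotient_range_pow q
  have hα : defect A = nullity A + extDim ℂ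
      (H ⧸ LinearMap.range (A : H →ₗ[ℂ] H) ⊔ LinearMap.ker ((A : H →ₗ[ℂ] H) ^ p)) :=
    extDim_quotient_range_eq_add hp
  have hβ : nullity B = defect B + extDim ℂ
      (LinearMap.ker (B : K →ₗ[ℂ] K) ⊓ LinearMap.range ((B : K →ₗ[ℂ] K) ^ q) : Submodule ℂ K) :=
    extDim_ker_eq_add hq
  have hK2cl : IsClosed (LinearMap.range ((B : K →ₗ[ℂ] K) ^ q) : Set K) := by
    rw [← ContinuousLinearMap.toLinearMap_pow] at hKfin ⊢
    exact isClosed_range_of_finiteDimensional_quotient_range (B ^ q)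
  have hK2surj : ∀ y ∈ LinearMap.range ((B : K →ₗ[ℂ] K) ^ q),
      ∃ w ∈ LinearMap.range ((B : K →ₗ[ℂ] K) ^ q), B w = y := by
    intro y hy
    rw [hq] at hy
    obtain ⟨w, rfl⟩ := hy
    exact ⟨((B : K →ₗ[ℂ] K) ^ q) w, LinearMap.mem_range_self _ _, by
      rw [pow_succ', Module.End.mul_apply]; rfl⟩
  have hK2maps : ∀ y ∈ LinearMap.range ((B : K →ₗ[ℂ] K) ^ q),
      B y ∈ LinearMap.range ((B : K →ₗ[ℂ] K) ^ q) := by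
    rintro _ ⟨y, rfl⟩
    refine ⟨B y, ?_⟩
    change ((B : K →ₗ[ℂ] K) ^ q * (B : K →ₗ[ℂ] K)) y = ((B : K →ₗ[ℂ] K) * (B : K →ₗ[ℂ] K) ^ q) y
    rw [← pow_succ, ← pow_succ']
  set H1 := LinearMap.ker ((A : H →ₗ[ℂ] H) ^ p)
  set K2 := LinearMap.range ((B : K →ₗ[ℂ] K) ^ q)
  set P := LinearMap.range (A : H →ₗ[ℂ] H) ⊔ H1
  set L := LinearMap.ker (B : K →ₗ[ℂ] K) ⊓ K2
  have hPcl : IsClosed (P : Set H) := isClosed_sup_finiteDimensional _ _ hAcl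
  have hLcl : IsClosed (L : Set K) := B.isClosed_ker.inter hK2cl
  have hPc : CompleteSpace P := hPcl.completeSpace_coe
  have hLc : CompleteSpace L := hLcl.completeSpace_coe
  have hdim : extDim ℂ L = extDim ℂ Pᗮ := by
    rw [← (P.quotientEquivOfIsCompl Pᗮ P.isCompl_orthogonal).extDim_eq]
    -- The index condition reads `α(A) + β(B) + dim L = α(A) + β(B) + dim H ⧸ P`, and
    -- `α(A) + β(B)` is finite even when `β(A)` and `α(B)` are not.
    have hne : nullity A + defect B ≠ ⊤ := (ENat.add_lt_top.2 ⟨hAα, hBβ⟩).ne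
    refine ENat.add_right_injective_of_ne_top hne ?_
    change nullity A + defect B + _ = nullity A + defect B + _
    rw [add_assoc, ← hβ, hAB, hα]
    abel
  obtain ⟨e⟩ := nonempty_continuousLinearEquiv_of_extDim_eq hdim
  -- The orthogonal projection onto `L` extends the isomorphism by zero to all of `K`.
  let C : K →L[ℂ] H := Pᗮ.subtypeL ∘L (e : L →L[ℂ] Pᗮ) ∘L L.orthogonalProjectionOnto
  have hCL : ∀ y : L, C y = e y := fun y => by
    simp [C, orthogonalProjectionOnto_mem_subspace_eq_self]
  have hcofin : FiniteDimensional ℂ (WithLp 2 (H × K) ⧸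
      K2.comap (WithLp.sndL 2 ℂ H K : WithLp 2 (H × K) →ₗ[ℂ] K)) := by
    have h := CoFG.ker (K2.mkQ ∘ₗ (WithLp.sndL 2 ℂ H K : WithLp 2 (H × K) →ₗ[ℂ] K))
    rwa [LinearMap.ker_comp, ker_mkQ] at h
  refine ⟨C, isBrowder_of_bijective_subquotient
    (N := H1.map (inlL H K : H →ₗ[ℂ] WithLp 2 (H × K)))
    (R := K2.comap (WithLp.sndL 2 ℂ H K : WithLp 2 (H × K) →ₗ[ℂ] K))
    (p := p) (q := q) ?_ ?_ ?_ ?_ ?_⟩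
  · rintro _ ⟨x, hx, rfl⟩
    rw [ContinuousLinearMap.coe_coe, upperTriangular_pow_inlL, LinearMap.mem_ker.1 hx, map_zero]
  · intro v
    exact ⟨v.snd, (upperTriangular_pow_snd q v).symm⟩
  · intro v hv
    exact hK2maps _ hv
  · rintro v hv ⟨h, hh, hMv⟩
    replace hMv : inlL H K h = upperTriangular A B C v := hMv
    rw [upperTriangular_apply] at hMv
    have e1 : h = A v.fst + C v.snd := congrArg (fun v : WithLp 2 (H × K) => v.fst) hMv
    have e2 : 0 = B v.snd := congrArg (fun v : WithLp 2 (H × K) => v.snd) hMv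
    -- `C v.snd` lies in `P` and in its orthogonal complement.
    have hvL : v.snd ∈ L := ⟨e2.symm, hv⟩
    have hC : C v.snd = e ⟨v.snd, hvL⟩ := hCL ⟨v.snd, hvL⟩
    have hCP : C v.snd ∈ P := by
      rw [show C v.snd = A (-v.fst) + h by rw [e1, map_neg]; abel]
      exact add_mem (mem_sup_left (LinearMap.mem_range_self _ _)) (mem_sup_right hh)
    have hC0 : C v.snd = 0 :=
      (disjoint_def.1 P.orthogonal_disjoint) _ hCP (hC ▸ (e ⟨v.snd, hvL⟩).2)
    have hv0 : v.snd = 0 := by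
      have : e ⟨v.snd, hvL⟩ = 0 := Subtype.ext (hC.symm.trans hC0)
      simpa using this
    rw [hC0, add_zero] at e1
    refine ⟨v.fst, ?_, WithLp.ofLp_injective 2 (Prod.ext rfl hv0.symm)⟩
    · change v.fst ∈ H1
      rw [hp, LinearMap.mem_ker, pow_succ, Module.End.mul_apply, ContinuousLinearMap.coe_coe, ← e1]
      exact hh
  · intro v hv
    obtain ⟨w, hw, hBw⟩ := hK2surj v.snd hv
    -- The component of `v.fst - C w` in the orthogonal complement of `P` is `C y` for some `y ∈ L`,
    -- and `B (w + y) = B w`.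
    obtain ⟨_, hx, z, hz, hsum⟩ := mem_sup.1
      (P.sup_orthogonal_of_hasOrthogonalProjection ▸ mem_top : v.fst - C w ∈ P ⊔ Pᗮ)
    obtain ⟨_, ⟨u, rfl⟩, h, hh, rfl⟩ := mem_sup.1 hx
    set y := e.symm ⟨z, hz⟩ with hy
    have hCy : C y = z := by rw [hCL, hy, e.apply_symm_apply]
    have hBy : B y = 0 := y.2.1
    refine mem_sup.2 ⟨_, ⟨WithLp.toLp 2 (u, w + y), K2.add_mem hw y.2.2, rfl⟩, _, ⟨h, hh, rfl⟩, ?_⟩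
    refine WithLp.ofLp_injective 2 (Prod.ext ?_ ?_)
    · change A u + C (w + y) + h = v.fst
      replace hsum : A u + h + z = v.fst - C w := hsum
      rw [map_add, hCy, ← sub_add_cancel v.fst (C w), ← hsum]
      abel
    · change B (w + y) + 0 = v.snd
      rw [map_add, hBy, hBw, add_zero, add_zero]

end Matrices

end BrowderSpectrum

theorem corollary2p11 {H K : Type*}
    [NormedAddCommGroup H] [InnerProductSpace ℂ H] [CompleteSpace H]
    [TopologicalSpace.SeparableSpace H] (hH : ¬ FiniteDimensional ℂ H)
    [NormedAddCommGroup K] [InnerProductSpace ℂ K] [CompleteSpace K]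
    [TopologicalSpace.SeparableSpace K] (hK : ¬ FiniteDimensional ℂ K)
    (A : H →L[ℂ] H) (B : K →L[ℂ] K) :
    (⋂ C : K →L[ℂ] H,
        BrowderSpectrum.browderSpectrum (BrowderSpectrum.upperTriangular A B C)) =
      BrowderSpectrum.leftBrowderSpectrum A ∪ BrowderSpectrum.rightBrowderSpectrum B ∪
        {l : ℂ |
          BrowderSpectrum.nullity (BrowderSpectrum.shift A l) +
              BrowderSpectrum.nullity (BrowderSpectrum.shift B l) ≠
            BrowderSpectrum.defect (BrowderSpectrum.shift A l) +
              BrowderSpectrum.defect (BrowderSpectrum.shift B l)} := by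
  have h : ∀ l : ℂ, (∃ C : K →L[ℂ] H, BrowderSpectrum.IsBrowder
      (BrowderSpectrum.shift (BrowderSpectrum.upperTriangular A B C) l)) ↔
      BrowderSpectrum.IsLeftSemiBrowder (BrowderSpectrum.shift A l) ∧
      BrowderSpectrum.IsRightSemiBrowder (BrowderSpectrum.shift B l) ∧
      BrowderSpectrum.nullity (BrowderSpectrum.shift A l) +
          BrowderSpectrum.nullity (BrowderSpectrum.shift B l) =
        BrowderSpectrum.defect (BrowderSpectrum.shift A l) +
          BrowderSpectrum.defect (BrowderSpectrum.shift B l) := by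
    intro l
    simp only [BrowderSpectrum.shift_upperTriangular]
    constructor
    · rintro ⟨C, hC⟩
      exact ⟨hC.isLeftSemiBrowder, hC.isRightSemiBrowder, hC.nullity_add_nullity_eq⟩
    · rintro ⟨hA, hB, hAB⟩
      exact BrowderSpectrum.exists_isBrowder_upperTriangular hA hB hAB
  ext l
  simp only [Set.mem_iInter, Set.mem_union, BrowderSpectrum.browderSpectrum,
    BrowderSpectrum.leftBrowderSpectrum, BrowderSpectrum.rightBrowderSpectrum, Set.mem_ofPred_eq]
  rw [← not_exists, h]
  tauto
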